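/- **Theorem 3.1 (monomial case).** Let $K$ be a field, let $R=K[x_1,\dots,x_n]$, $T=K[y_1,\dots,y_m]$ and $S=R\otimes_K T=K[x_1,\dots,x_n,y_1,\dots,y_m]$, and let $I\subset R$ and $J\subset T$ be nonzero proper monomial ideals. Denote the extended ideals $IS$ and $JS$ again by $I$ and $J$, and likewise write $\mathfrak p+\mathfrak q$ for the ideal $\mathfrak pS+\mathfrak qS$ of $S$ when $\mathfrak p\subset R$ and $\mathfrak q\subset T$ are ideals. For an ideal $L$ of a Noetherian ring $A$, let $\mathrm{Ass}(L)$ be the set of associated primes of the $A$-module $A/L$, put $\mathrm{Ass}^*(L)=\bigcup_{k\ge 1}\mathrm{Ass}(L^k)$, and let $\mathrm{Ass}^\infty(L)$ be the set of primes that belong to $\mathrm{Ass}(L^k)$ for all $k\gg 0$ (by Brodmann, the common value of the sets $\mathrm{Ass}(L^k)$ for $k\gg0$). Then $$ \mathrm{Ass}^\infty(I+J)\;=\;\bigcup_{\substack{\mathfrak p\in \mathrm{Ass}^*(I)\\ \mathfrak q\in \mathrm{Ass}^\infty(J)}}\{\mathfrak p+\mathfrak q\}\;\cup\;\bigcup_{\substack{\mathfrak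 p\in \mathrm{Ass}^\infty(I)\\ \mathfrak q\in \mathrm{Ass}^*(J)}}\{\mathfrak p+\mathfrak q\}, $$ where $\mathrm{Ass}^*(I),\mathrm{Ass}^\infty(I)$ are taken in $R$, $\mathrm{Ass}^*(J),\mathrm{Ass}^\infty(J)$ in $T$, and $\mathrm{Ass}^\infty(I+J)$ in $S$. -/

import Mathlib

/-- `I` is a monomial ideal: it is generated by a set of monomials. -/
def IsMonomialIdeal {σ K : Type*} [Field K] (I : Ideal (MvPolynomial σ K)) : Prop :=
  ∃ A : Set (σ →₀ ℕ), I = Ideal.span ((fun a => MvPolynomial.monomial a (1 : K)) '' A)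

/-- `Ass(I)`, the set of associated primes of the module `R ⧸ I`. -/
def assPrimes {R : Type*} [CommRing R] (I : Ideal R) : Set (Ideal R) :=
  associatedPrimes R (R ⧸ I)

/-- `Ass*(I)`, the union of the sets `Ass(I ^ k)` over all `k ≥ 1`. -/
def assStar {R : Type*} [CommRing R] (I : Ideal R) : Set (Ideal R) :=
  ⋃ k : ℕ, ⋃ _ : 1 ≤ k, assPrimes (I ^ k)

/-- `Ass^∞(I)`, the set of stable primes: the primes that lie in `Ass(I ^ k)` for all `k ≫ 0`.
When the sets `Ass(I ^ k)` are equal to one another for all `k ≫ 0` (as they always are in a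
Noetherian ring), this is their common value, see `assInfty_eq`. -/
def assInfty {R : Type*} [CommRing R] (I : Ideal R) : Set (Ideal R) :=
  {p | ∃ k₀ : ℕ, ∀ k : ℕ, k₀ ≤ k → p ∈ assPrimes (I ^ k)}

theorem assInfty_eq {R : Type*} [CommRing R] (I : Ideal R) (A : Set (Ideal R)) (k₀ : ℕ)
    (h : ∀ k : ℕ, k₀ ≤ k → assPrimes (I ^ k) = A) : assInfty I = A := by
  ext p
  constructor
  · rintro ⟨k₁, hk⟩
    rw [← h (max k₀ k₁) (le_max_left _ _)]
    exact hk _ (le_max_right _ _)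
  · intro hp
    exact ⟨k₀, fun k hk => by rw [h k hk]; exact hp⟩

/-- The extension `IS` of an ideal `I` of `K[x₁, …, xₙ]` to
`S = K[x₁, …, xₙ, y₁, …, yₘ]`. -/
noncomputable def extendX {K : Type*} [Field K] {n : ℕ} (m : ℕ)
    (I : Ideal (MvPolynomial (Fin n) K)) : Ideal (MvPolynomial (Fin n ⊕ Fin m) K) :=
  I.map (MvPolynomial.rename (R := K) (Sum.inl : Fin n → Fin n ⊕ Fin m))

/-- The extension `JS` of an ideal `J` of `K[y₁, …, yₘ]` to
`S = K[x₁, …, xₙ, y₁, …, yₘ]`. -/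
noncomputable def extendY {K : Type*} [Field K] (n : ℕ) {m : ℕ}
    (J : Ideal (MvPolynomial (Fin m) K)) : Ideal (MvPolynomial (Fin n ⊕ Fin m) K) :=
  J.map (MvPolynomial.rename (R := K) (Sum.inr : Fin m → Fin n ⊕ Fin m))

/-! ### Membership of monomials in sums, products and powers of monomial ideals. -/

section Monomial

open MvPolynomial

variable {σ K : Type*} [Field K]

/-! An associated prime of a monomial ideal `L` is generated by a set `V` of variables and has the
form `L : x^a` for a monomial `x^a`, so everything reduces to exponents
(`IsMonomialIdeal.exists_monomial_colon`, `IsColonWitness`). A monomial `x^a y^b` lies in `(I +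
J)^k` iff `x^a ∈ I^i` and `y^b ∈ J^j` for some `i + j = k`.

Witnesses `x^a` for `I^(i+1)` and `y^b` for `J^(j+1)` lie in `I^i` and `J^j`, which makes `x^a y^b`
a witness for `(I + J)^(i+j+1)` (`IsColonWitness.extend_add`). Fixing one exponent and letting the
other grow gives the inclusion `⊇`.

Conversely, a witness for `(I + J)^k` splits into witnesses for some `I^i` and `J^j` with `i + j ≥
k` (`IsColonWitness.of_extend_add`). As `k` grows, `i` or `j` is unbounded, so one of the two primes
is associated to infinitely many powers. Such a prime is stable, by an Artin–Rees argument
(`mem_assInfty_of_frequently`). -/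

theorem IsMonomialIdeal.mem_iff {L : Ideal (MvPolynomial σ K)} (hL : IsMonomialIdeal L)
    (f : MvPolynomial σ K) : f ∈ L ↔ ∀ u ∈ f.support, monomial u (1 : K) ∈ L := by
  classical
  obtain ⟨A, rfl⟩ := hL
  simp only [mem_ideal_span_monomial_image, support_monomial, one_ne_zero, if_false,
    Finset.mem_singleton, forall_eq]

theorem monomial_mem_of_le {L : Ideal (MvPolynomial σ K)} {u v : σ →₀ ℕ} (huv : u ≤ v)
    (hu : monomial u (1 : K) ∈ L) : monomial v (1 : K) ∈ L := by
  obtain ⟨w, rfl⟩ := exists_add_of_le huv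
  simpa [monomial_mul] using L.mul_mem_right (monomial w 1) hu

theorem isMonomialIdeal_of_mem {L : Ideal (MvPolynomial σ K)}
    (hL : ∀ f ∈ L, ∀ u ∈ f.support, monomial u (1 : K) ∈ L) : IsMonomialIdeal L := by
  refine ⟨{u | monomial u (1 : K) ∈ L}, le_antisymm (fun f hf => ?_) ?_⟩
  · rw [mem_ideal_span_monomial_image]
    exact fun u hu => ⟨u, hL f hf u hu, le_rfl⟩
  · rw [Ideal.span_le]
    rintro _ ⟨u, hu, rfl⟩
    exact hu

theorem IsMonomialIdeal.sup {L M : Ideal (MvPolynomial σ K)} (hL : IsMonomialIdeal L)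
    (hM : IsMonomialIdeal M) : IsMonomialIdeal (L ⊔ M) := by
  obtain ⟨A, rfl⟩ := hL
  obtain ⟨B, rfl⟩ := hM
  exact ⟨A ∪ B, by rw [Set.image_union, Ideal.span_union]⟩

theorem IsMonomialIdeal.mul {L M : Ideal (MvPolynomial σ K)} (hL : IsMonomialIdeal L)
    (hM : IsMonomialIdeal M) : IsMonomialIdeal (L * M) := by
  obtain ⟨A, rfl⟩ := hL
  obtain ⟨B, rfl⟩ := hM
  refine ⟨Set.image2 (· + ·) A B, ?_⟩
  rw [Ideal.span_mul_span']
  congr 1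
  ext f
  simp only [Set.mem_mul, Set.mem_image, Set.mem_image2]
  constructor
  · rintro ⟨_, ⟨a, ha, rfl⟩, _, ⟨b, hb, rfl⟩, rfl⟩
    exact ⟨a + b, ⟨a, ha, b, hb, rfl⟩, by simp [monomial_mul]⟩
  · rintro ⟨_, ⟨a, ha, b, hb, rfl⟩, rfl⟩
    exact ⟨_, ⟨a, ha, rfl⟩, _, ⟨b, hb, rfl⟩, by simp [monomial_mul]⟩

theorem isMonomialIdeal_top : IsMonomialIdeal (⊤ : Ideal (MvPolynomial σ K)) :=
  isMonomialIdeal_of_mem fun _ _ _ _ => trivial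

theorem IsMonomialIdeal.pow {L : Ideal (MvPolynomial σ K)} (hL : IsMonomialIdeal L) (k : ℕ) :
    IsMonomialIdeal (L ^ k) := by
  induction k with
  | zero => simpa using isMonomialIdeal_top
  | succ k ih => rw [pow_succ]; exact ih.mul hL

theorem IsMonomialIdeal.map_rename {τ : Type*} {L : Ideal (MvPolynomial σ K)}
    (hL : IsMonomialIdeal L) (e : σ → τ) :
    IsMonomialIdeal (L.map (rename (R := K) e)) := by
  obtain ⟨A, rfl⟩ := hL
  refine ⟨Finsupp.mapDomain e '' A, ?_⟩
  rw [Ideal.map_span, Set.image_image, Set.image_image]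
  simp [rename_monomial]

theorem monomial_mem_span_iff {A : Set (σ →₀ ℕ)} {u : σ →₀ ℕ} :
    monomial u (1 : K) ∈ Ideal.span ((fun a => monomial a (1 : K)) '' A) ↔ ∃ a ∈ A, a ≤ u := by
  classical
  simp [mem_ideal_span_monomial_image, support_monomial]

theorem IsMonomialIdeal.monomial_mem_sup {L M : Ideal (MvPolynomial σ K)}
    (hL : IsMonomialIdeal L) (hM : IsMonomialIdeal M) {u : σ →₀ ℕ} :
    monomial u (1 : K) ∈ L ⊔ M ↔ monomial u (1 : K) ∈ L ∨ monomial u (1 : K) ∈ M := by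
  obtain ⟨A, rfl⟩ := hL
  obtain ⟨B, rfl⟩ := hM
  rw [← Ideal.span_union, ← Set.image_union]
  simp only [monomial_mem_span_iff, Set.mem_union, or_and_right, exists_or]

theorem IsMonomialIdeal.monomial_mem_mul {L M : Ideal (MvPolynomial σ K)}
    (hL : IsMonomialIdeal L) (hM : IsMonomialIdeal M) {u : σ →₀ ℕ} :
    monomial u (1 : K) ∈ L * M ↔
      ∃ a b, monomial a (1 : K) ∈ L ∧ monomial b (1 : K) ∈ M ∧ a + b = u := by
  constructor
  · obtain ⟨A, rfl⟩ := hL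
    obtain ⟨B, rfl⟩ := hM
    have : Ideal.span ((fun a => monomial a (1 : K)) '' A) *
        Ideal.span ((fun a => monomial a (1 : K)) '' B) =
        Ideal.span ((fun a => monomial a (1 : K)) '' Set.image2 (· + ·) A B) := by
      rw [Ideal.span_mul_span', ← Set.image2_mul, Set.image2_image_left, Set.image2_image_right,
        Set.image_image2]
      simp [monomial_mul]
    rw [this, monomial_mem_span_iff]
    rintro ⟨_, ⟨a, ha, b, hb, rfl⟩, h⟩
    obtain ⟨w, rfl⟩ := exists_add_of_le h
    exact ⟨a, b + w, monomial_mem_span_iff.2 ⟨a, ha, le_rfl⟩,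
      monomial_mem_span_iff.2 ⟨b, hb, by simp⟩, by rw [add_assoc]⟩
  · rintro ⟨a, b, ha, hb, rfl⟩
    simpa [monomial_mul] using Ideal.mul_mem_mul ha hb

/-- Dividing by one variable damages at most one factor of a product of `k + 1` elements of `L`.
This places colon witnesses for `L ^ (k + 1)` in `L ^ k`. -/
theorem IsMonomialIdeal.monomial_mem_pow_of_single_add {L : Ideal (MvPolynomial σ K)}
    (hL : IsMonomialIdeal L) (i : σ) (k : ℕ) (a : σ →₀ ℕ)
    (h : monomial (a + Finsupp.single i 1) (1 : K) ∈ L ^ (k + 1)) :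
    monomial a (1 : K) ∈ L ^ k := by
  induction k generalizing a with
  | zero => simp
  | succ k ih =>
    rw [pow_succ, (hL.pow _).monomial_mem_mul hL] at h
    obtain ⟨c, d, hc, hd, hcd⟩ := h
    by_cases hdi : d i = 0
    · have hci : Finsupp.single i 1 ≤ c := by
        have := DFunLike.congr_fun hcd i
        simp only [Finsupp.add_apply, Finsupp.single_eq_same] at this
        rw [Finsupp.single_le_iff]
        omega
      obtain ⟨w, rfl⟩ := exists_add_of_le hci
      have hw := ih w (add_comm (Finsupp.single i 1) w ▸ hc)
      have : a = w + d := by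
        apply add_right_cancel (b := Finsupp.single i 1)
        rw [← hcd]; abel
      rw [this, pow_succ]
      exact ((hL.pow _).monomial_mem_mul hL).2 ⟨w, d, hw, hd, rfl⟩
    · have hdi' : Finsupp.single i 1 ≤ d := by
        rw [Finsupp.single_le_iff]
        omega
      obtain ⟨w, rfl⟩ := exists_add_of_le hdi'
      have : a = c + w := by
        apply add_right_cancel (b := Finsupp.single i 1)
        rw [← hcd]; abel
      rw [this]
      exact monomial_mem_of_le (by simp) hc

theorem IsMonomialIdeal.exists_reduction {L : Ideal (MvPolynomial σ K)} (f : MvPolynomial σ K)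
    (hL : IsMonomialIdeal L) : ∃ f' : MvPolynomial σ K, f - f' ∈ L ∧ f'.support ⊆ f.support ∧
      ∀ u ∈ f'.support, monomial u (1 : K) ∉ L := by
  classical
  refine ⟨∑ u ∈ f.support with monomial u (1 : K) ∉ L, monomial u (f.coeff u), ?_, ?_, ?_⟩
  · rw [hL.mem_iff]
    intro u hu
    by_contra h
    rw [mem_support_iff, coeff_sub, coeff_sum] at hu
    apply hu
    simp only [coeff_monomial, Finset.sum_ite_eq', Finset.mem_filter, mem_support_iff]
    by_cases h0 : f.coeff u = 0 <;> simp [h, h0]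
  all_goals
    intro u hu
    rw [mem_support_iff, coeff_sum] at hu
    simp only [coeff_monomial, Finset.sum_ite_eq', Finset.mem_filter, ne_eq, ite_eq_right_iff,
      not_forall] at hu
    obtain ⟨hu, -⟩ := hu
  · exact hu.1
  · exact hu.2

/-- Some sum of exponents is attained by only one pair, so no cancellation can occur there. -/
theorem exists_coeff_add_mul_ne_zero {f g : MvPolynomial σ K} (hf : f ≠ 0) (hg : g ≠ 0) :
    ∃ a ∈ f.support, ∃ b ∈ g.support, a + b ∈ (f * g).support := by
  obtain ⟨a, ha, b, hb, h⟩ := UniqueSums.uniqueAdd_of_nonempty (support_nonempty.2 hf)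
    (support_nonempty.2 hg)
  refine ⟨a, ha, b, hb, ?_⟩
  have := AddMonoidAlgebra.coeff_mul_add_of_uniqueAdd (f := f) (g := g) h
  rw [mem_support_iff]
  change coeff (a + b) (f * g) = coeff a f * coeff b g at this
  rw [this]
  exact mul_ne_zero (mem_support_iff.1 ha) (mem_support_iff.1 hb)

/-- If `f ∉ P`, `g ∉ Q` but `f * g ∈ L`, where `P * (g)`, `(f) * Q` and `P * Q` lie in `L`, then
the monomials of `f` and `g` outside `P` and `Q` contain a pair whose product lies in `L`. -/
theorem IsMonomialIdeal.exists_add_mem {L P Q : Ideal (MvPolynomial σ K)}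
    (hL : IsMonomialIdeal L) (hP : IsMonomialIdeal P) (hQ : IsMonomialIdeal Q)
    {f g : MvPolynomial σ K} (hf : f ∉ P) (hg : g ∉ Q) (hfg : f * g ∈ L)
    (hPg : ∀ h ∈ P, h * g ∈ L) (hQf : ∀ h ∈ Q, f * h ∈ L) (hPQ : P * Q ≤ L) :
    ∃ a ∈ f.support, ∃ b ∈ g.support, monomial a (1 : K) ∉ P ∧ monomial b (1 : K) ∉ Q ∧
      monomial (a + b) (1 : K) ∈ L := by
  obtain ⟨f', hf1, hf2, hf3⟩ := hP.exists_reduction f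
  obtain ⟨g', hg1, hg2, hg3⟩ := hQ.exists_reduction g
  have hf0 : f' ≠ 0 := by rintro rfl; exact hf (by simpa using hf1)
  have hg0 : g' ≠ 0 := by rintro rfl; exact hg (by simpa using hg1)
  obtain ⟨a, ha, b, hb, hab⟩ := exists_coeff_add_mul_ne_zero hf0 hg0
  refine ⟨a, hf2 ha, b, hg2 hb, hf3 a ha, hg3 b hb, ?_⟩
  refine (hL.mem_iff (f' * g')).1 ?_ _ hab
  have : f' * g' = f * g - (f - f') * g - f * (g - g') + (f - f') * (g - g') := by ring
  rw [this]
  exact L.add_mem (L.sub_mem (L.sub_mem hfg (hPg _ hf1)) (hQf _ hg1))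
    (hPQ (Ideal.mul_mem_mul hf1 hg1))

/-! ### Primes generated by variables and monomial colon witnesses. -/

theorem isMonomialIdeal_span_X (V : Set σ) :
    IsMonomialIdeal (Ideal.span (X '' V : Set (MvPolynomial σ K))) :=
  ⟨(fun i => Finsupp.single i 1) '' V, by rw [Set.image_image]; rfl⟩

theorem monomial_mem_span_X_iff {V : Set σ} {u : σ →₀ ℕ} :
    monomial u (1 : K) ∈ Ideal.span (X '' V : Set (MvPolynomial σ K)) ↔ ∃ i ∈ V, u i ≠ 0 := by
  classical
  simp [mem_ideal_span_X_image, support_monomial]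

theorem isPrime_span_X (V : Set σ) :
    (Ideal.span (X '' V : Set (MvPolynomial σ K))).IsPrime := by
  have hV := isMonomialIdeal_span_X (K := K) V
  refine ⟨?_, fun {f g} hfg => ?_⟩
  · rw [Ideal.ne_top_iff_one, show (1 : MvPolynomial σ K) = monomial 0 1 from rfl,
      monomial_mem_span_X_iff]
    simp
  · by_contra! h
    obtain ⟨a, -, b, -, ha, hb, hab⟩ := hV.exists_add_mem hV hV h.1 h.2 hfg
      (fun h hh => Ideal.mul_mem_right _ _ hh) (fun h hh => Ideal.mul_mem_left _ _ hh)
      Ideal.mul_le_left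
    rw [monomial_mem_span_X_iff] at ha hb hab
    push Not at ha hb
    obtain ⟨i, hi, h⟩ := hab
    exact h (by simp [ha i hi, hb i hi])

theorem mem_assPrimes_iff {R : Type*} [CommRing R] [IsNoetherianRing R] {I p : Ideal R} :
    p ∈ assPrimes I ↔ p.IsPrime ∧ ∃ g : R, ∀ f, f ∈ p ↔ f * g ∈ I := by
  refine (Submodule.isAssociatedPrime_iff (N := (⊥ : Submodule R (R ⧸ I)))).trans
    (and_congr_right fun _ => ?_)
  rw [(Ideal.Quotient.mk_surjective (I := I)).exists]
  refine exists_congr fun g => ?_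
  rw [Ideal.ext_iff]
  refine forall_congr' fun f => ?_
  rw [Submodule.mem_colon_singleton, Submodule.mem_bot,
    ← Ideal.Quotient.eq_zero_iff_mem (I := I), map_mul]
  rfl

/-- `L : x ^ a` is the prime ideal generated by the variables in `V`, as far as monomials are
concerned. -/
def IsColonWitness (L : Ideal (MvPolynomial σ K)) (V : Set σ) (a : σ →₀ ℕ) : Prop :=
  ∀ u : σ →₀ ℕ, monomial (a + u) (1 : K) ∈ L ↔ ∃ i ∈ V, u i ≠ 0

theorem IsMonomialIdeal.isColonWitness_iff {L : Ideal (MvPolynomial σ K)}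
    (hL : IsMonomialIdeal L) (V : Set σ) (a : σ →₀ ℕ) : IsColonWitness L V a ↔
      ∀ f, f ∈ Ideal.span (X '' V : Set (MvPolynomial σ K)) ↔ f * monomial a 1 ∈ L := by
  classical
  constructor
  · intro h f
    rw [hL.mem_iff, (isMonomialIdeal_span_X V).mem_iff]
    constructor
    · intro hf u hu
      obtain ⟨hau, -⟩ : a ≤ u ∧ _ := by
        rw [mem_support_iff, coeff_mul_monomial'] at hu
        simpa using hu
      obtain ⟨w, rfl⟩ := exists_add_of_le hau
      rw [mem_support_iff, add_comm, coeff_mul_monomial, mul_one, ← mem_support_iff] at hu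
      exact (h w).2 (monomial_mem_span_X_iff.1 (hf w hu))
    · intro hf u hu
      refine monomial_mem_span_X_iff.2 ((h u).1 ?_)
      apply hf
      rw [mem_support_iff] at hu ⊢
      rwa [add_comm, coeff_mul_monomial, mul_one]
  · intro h u
    rw [← monomial_mem_span_X_iff (K := K), h, monomial_mul, one_mul, add_comm]

theorem IsPrime.monomial_mem_iff {P : Ideal (MvPolynomial σ K)} (hP : P.IsPrime) (u : σ →₀ ℕ) :
    monomial u (1 : K) ∈ P ↔ ∃ i, X i ∈ P ∧ u i ≠ 0 := by
  rw [monomial_eq, C_1, one_mul, Finsupp.prod, hP.prod_mem_iff]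
  constructor
  · rintro ⟨i, -, hi⟩
    refine ⟨i, hP.mem_of_pow_mem _ hi, fun h => ?_⟩
    rw [h, pow_zero] at hi
    exact hP.ne_top ((Ideal.eq_top_iff_one _).2 hi)
  · rintro ⟨i, hi, h⟩
    exact ⟨i, by simpa using h, P.pow_mem_of_mem hi _ (Nat.pos_of_ne_zero h)⟩

/-- The conclusion says at once that `P` is monomial and that `P = L : x^a`. Any term of a witness
`g` with the fewest terms provides `a`. -/
theorem IsMonomialIdeal.exists_monomial_colon {L P : Ideal (MvPolynomial σ K)}
    (hL : IsMonomialIdeal L) (hP : P.IsPrime)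
    (h : ∃ g : MvPolynomial σ K, ∀ f, f ∈ P ↔ f * g ∈ L) :
    ∃ a : σ →₀ ℕ, ∀ f, f ∈ P ↔ ∀ u ∈ f.support, monomial (u + a) (1 : K) ∈ L := by
  classical
  obtain ⟨g, hg, hmin⟩ := exists_minimalFor_of_wellFoundedLT
    (fun g : MvPolynomial σ K => ∀ f, f ∈ P ↔ f * g ∈ L) (fun g => g.support.card) h
  -- If `x^u ∉ P`, then `x^u g` is again a witness since `P` is prime; reducing it modulo `L` would
  -- drop the term `x^(u+a)`, against minimality.
  have key : ∀ u, ∀ a ∈ g.support, monomial (u + a) (1 : K) ∈ L → monomial u (1 : K) ∈ P := by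
    intro u a ha hua
    by_contra hu
    obtain ⟨g', hg1, hg2, hg3⟩ := hL.exists_reduction (monomial u (1 : K) * g)
    have hg' : ∀ f, f ∈ P ↔ f * g' ∈ L := by
      intro f
      have h1 : f * g' ∈ L ↔ f * (monomial u 1 * g) ∈ L := by
        have := L.mul_mem_left f hg1
        rw [mul_sub] at this
        exact ⟨fun h => by simpa using L.add_mem this h, fun h => by simpa using L.sub_mem h this⟩
      rw [h1, ← mul_assoc, ← hg]
      exact ⟨fun h => P.mul_mem_right _ h, fun h => (hP.mem_or_mem h).resolve_right hu⟩
    have hsub : g'.support.image id ⊆ (g.support.erase a).image (u + ·) := by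
      intro v hv
      rw [Finset.image_id] at hv
      have hv' := hg2 hv
      obtain ⟨w, rfl⟩ : ∃ w, v = u + w := by
        rw [mem_support_iff, coeff_monomial_mul'] at hv'
        exact exists_add_of_le (by simp at hv'; exact hv'.1)
      rw [mem_support_iff, coeff_monomial_mul, one_mul] at hv'
      refine Finset.mem_image.2 ⟨w, Finset.mem_erase.2 ⟨?_, mem_support_iff.2 hv'⟩, rfl⟩
      rintro rfl
      exact hg3 _ hv hua
    rw [Finset.image_id] at hsub
    have hlt : g'.support.card < g.support.card :=
      ((Finset.card_le_card hsub).trans Finset.card_image_le).trans_lt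
        (Finset.card_erase_lt_of_mem ha)
    exact absurd (hmin hg' hlt.le) (not_le.2 hlt)
  have key2 : ∀ u, monomial u (1 : K) ∈ P → ∀ a ∈ g.support, monomial (u + a) (1 : K) ∈ L := by
    intro u hu a ha
    refine (hL.mem_iff _).1 ((hg _).1 hu) _ ?_
    rw [mem_support_iff, coeff_monomial_mul, one_mul]
    exact mem_support_iff.1 ha
  have hg0 : g ≠ 0 := by
    rintro rfl
    exact hP.ne_top ((Ideal.eq_top_iff_one _).2 ((hg 1).2 (by simp)))
  have hgL : g ∉ L := fun h => hP.ne_top ((Ideal.eq_top_iff_one _).2 ((hg 1).2 (by simpa using h)))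
  obtain ⟨a, ha⟩ := support_nonempty.2 hg0
  refine ⟨a, fun f => ⟨fun hf u hu => ?_, fun hf => ?_⟩⟩
  · refine key2 u ?_ a ha
    -- `Q` is the largest monomial ideal inside `P`. An `f ∈ P` outside `Q` would have a term
    -- outside `Q` that `key` puts in `P`.
    let Q : Ideal (MvPolynomial σ K) :=
      Ideal.span ((fun u => monomial u (1 : K)) '' {u | monomial u (1 : K) ∈ P})
    have hQ : IsMonomialIdeal Q := ⟨_, rfl⟩
    have hQP : Q ≤ P := by
      refine Ideal.span_le.2 ?_
      rintro _ ⟨u, hu, rfl⟩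
      exact hu
    by_cases hfQ : f ∈ Q
    · exact hQP ((hQ.mem_iff f).1 hfQ u hu)
    · obtain ⟨c, -, b, hb, hc, -, hcb⟩ := hL.exists_add_mem hQ hL hfQ hgL ((hg f).1 hf)
        (fun h hh => (hg h).1 (hQP hh)) (fun h hh => L.mul_mem_left _ hh) Ideal.mul_le_right
      exact (hc (Ideal.subset_span (Set.mem_image_of_mem _ (key c b hb hcb)))).elim
  · rw [← f.support_sum_monomial_coeff]
    refine P.sum_mem fun u hu => ?_
    have := P.mul_mem_left (C (f.coeff u)) (key u a ha (hf u hu))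
    rwa [C_mul_monomial, mul_one] at this

theorem IsMonomialIdeal.span_X_mem_assPrimes_iff [Finite σ] {L : Ideal (MvPolynomial σ K)}
    (hL : IsMonomialIdeal L) (V : Set σ) :
    Ideal.span (X '' V) ∈ assPrimes L ↔ ∃ a, IsColonWitness L V a := by
  classical
  rw [mem_assPrimes_iff]
  constructor
  · rintro ⟨hP, h⟩
    obtain ⟨a, ha⟩ := hL.exists_monomial_colon hP h
    refine ⟨a, fun u => ?_⟩
    rw [← monomial_mem_span_X_iff (K := K), ha, add_comm a]
    simp [support_monomial]
  · rintro ⟨a, ha⟩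
    exact ⟨isPrime_span_X V, _, (hL.isColonWitness_iff V a).1 ha⟩

theorem IsMonomialIdeal.exists_eq_span_X_of_mem_assPrimes [Finite σ]
    {L P : Ideal (MvPolynomial σ K)} (hL : IsMonomialIdeal L) (hP : P ∈ assPrimes L) :
    ∃ V : Set σ, P = Ideal.span (X '' V) := by
  classical
  rw [mem_assPrimes_iff] at hP
  obtain ⟨hP, h⟩ := hP
  obtain ⟨a, ha⟩ := hL.exists_monomial_colon hP h
  refine ⟨{i | X i ∈ P}, le_antisymm (fun f hf => ?_) ?_⟩
  · rw [mem_ideal_span_X_image]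
    intro u hu
    refine (IsPrime.monomial_mem_iff hP u).1 ((ha _).2 ?_)
    simpa [support_monomial] using (ha f).1 hf u hu
  · refine Ideal.span_le.2 ?_
    rintro _ ⟨i, hi, rfl⟩
    exact hi

theorem IsColonWitness.nonempty {L : Ideal (MvPolynomial σ K)} (hL : IsMonomialIdeal L)
    (hL0 : L ≠ ⊥) {V : Set σ} {a : σ →₀ ℕ} (h : IsColonWitness L V a) : V.Nonempty := by
  obtain ⟨f, hf, hf0⟩ := Submodule.exists_mem_ne_zero_of_ne_bot hL0
  obtain ⟨u, hu⟩ := support_nonempty.2 hf0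
  obtain ⟨i, hi, -⟩ := (h u).1 (monomial_mem_of_le (by simp) ((hL.mem_iff f).1 hf u hu))
  exact ⟨i, hi⟩

theorem IsColonWitness.exists_succ {L : Ideal (MvPolynomial σ K)} {k : ℕ} {V : Set σ}
    {a : σ →₀ ℕ} (h : IsColonWitness (L ^ k) V a) : ∃ l, k = l + 1 := by
  refine Nat.exists_eq_succ_of_ne_zero ?_
  rintro rfl
  simpa using (h 0).1 (by simp)

theorem IsColonWitness.mem_pow {L : Ideal (MvPolynomial σ K)} (hL : IsMonomialIdeal L)
    (hL0 : L ≠ ⊥) {k : ℕ} {V : Set σ} {a : σ →₀ ℕ} (h : IsColonWitness (L ^ (k + 1)) V a) :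
    monomial a (1 : K) ∈ L ^ k := by
  obtain ⟨i, hi⟩ := h.nonempty (hL.pow _) (pow_ne_zero _ hL0)
  exact hL.monomial_mem_pow_of_single_add i k a ((h _).2 ⟨i, hi, by simp⟩)

end Monomial

/-! ### Primes associated to infinitely many powers are stable. -/

section Persistence

/-- The filtration `I ^ k ⊓ (I ^ (k + 1) : p)`, the preimage of the submodule annihilated by `p` in
the associated graded ring of `I`. -/
def Ideal.socleFiltration {R : Type*} [CommRing R] (I p : Ideal R) : I.Filtration R where
  N k :=
    { carrier := {f | f ∈ I ^ k ∧ ∀ s ∈ p, s * f ∈ I ^ (k + 1)}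
      add_mem' := fun {f g} hf hg => ⟨Ideal.add_mem _ hf.1 hg.1, fun s hs => by
        rw [mul_add]; exact Ideal.add_mem _ (hf.2 s hs) (hg.2 s hs)⟩
      zero_mem' := ⟨Ideal.zero_mem _, fun s _ => by simp⟩
      smul_mem' := fun c f hf => ⟨Ideal.mul_mem_left _ _ hf.1, fun s hs => by
        rw [smul_eq_mul, mul_left_comm]; exact Ideal.mul_mem_left _ _ (hf.2 s hs)⟩ }
  mono k f hf := ⟨Ideal.pow_le_pow_right k.le_succ hf.1,
    fun _ _ => Ideal.mul_mem_left _ _ hf.1⟩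
  smul_le k := by
    refine Submodule.smul_le.2 fun c hc f hf => ⟨?_, fun s hs => ?_⟩
    · rw [pow_succ']; exact Ideal.mul_mem_mul hc hf.1
    · rw [pow_succ', smul_eq_mul, mul_left_comm]; exact Ideal.mul_mem_mul hc (hf.2 s hs)

/-- Artin–Rees: it is a subfiltration of the `I`-adic one. -/
theorem Ideal.socleFiltration_stable {R : Type*} [CommRing R] [IsNoetherianRing R]
    (I p : Ideal R) : (I.socleFiltration p).Stable := by
  refine (I.stableFiltration_stable ⊤).of_le (F' := I.socleFiltration p) fun k f hf => ?_
  change f ∈ I ^ k • (⊤ : Ideal R)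
  simpa using hf.1

/-- If the powers of `I` have the property that primes of `Ass (I ^ (k + 1))` come from
`I ^ k / I ^ (k + 1)`, then a prime associated to infinitely many powers is stable. -/
theorem mem_assInfty_of_frequently {R : Type*} [CommRing R] [IsNoetherianRing R] {I p : Ideal R}
    (hI : ∀ k, p ∈ assPrimes (I ^ (k + 1)) →
      ∃ g ∈ I ^ k, ∀ f, f ∈ p ↔ f * g ∈ I ^ (k + 1))
    (h : ∀ N, ∃ k, N ≤ k ∧ p ∈ assPrimes (I ^ k)) : p ∈ assInfty I := by
  obtain ⟨n₀, hn₀⟩ := I.socleFiltration_stable p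
  have hp : p.IsPrime := by
    obtain ⟨k, -, hk⟩ := h 0
    exact (mem_assPrimes_iff.1 hk).1
  have step : ∀ k, n₀ ≤ k → p ∈ assPrimes (I ^ (k + 2)) → p ∈ assPrimes (I ^ (k + 1)) := by
    intro k hk hpk
    obtain ⟨g, hg, hgp⟩ := hI _ hpk
    by_contra hcon
    have hN : g ∈ (I.socleFiltration p).N (k + 1) := ⟨hg, fun s hs => (hgp s).1 hs⟩
    rw [← hn₀ k hk] at hN
    -- By stability `g` is a sum of products `c * f` with `c ∈ I` and `f` one level down. As `p ∉
    -- Ass(I^(k+1))`, each such `f` is pushed into `I^(k+1)` by some `s ∉ p`; the product of these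
    -- `s` pushes `g` into `I^(k+2)`.
    have hs : ∃ s, s ∉ p ∧ s * g ∈ I ^ (k + 2) := by
      refine Submodule.smul_induction_on hN (fun c hc f hf => ?_) ?_
      · by_contra! hall
        refine hcon (mem_assPrimes_iff.2 ⟨hp, f, fun s => ⟨fun hs => hf.2 s hs, fun hs => ?_⟩⟩)
        by_contra hsp
        refine hall s hsp ?_
        rw [smul_eq_mul, mul_left_comm, pow_succ']
        exact Ideal.mul_mem_mul hc hs
      · rintro x y ⟨s, hs, hsx⟩ ⟨t, ht, hty⟩
        refine ⟨s * t, fun h => (hp.mem_or_mem h).elim hs ht, ?_⟩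
        have : s * t * (x + y) = t * (s * x) + s * (t * y) := by ring
        rw [this]
        exact Ideal.add_mem _ (Ideal.mul_mem_left _ _ hsx) (Ideal.mul_mem_left _ _ hty)
    obtain ⟨s, hs, hsg⟩ := hs
    exact hs ((hgp s).2 hsg)
  refine ⟨n₀ + 1, fun k hk => ?_⟩
  obtain ⟨l, hl, hpl⟩ := h k
  induction l, hl using Nat.le_induction with
  | base => exact hpl
  | succ l hl ih =>
    obtain ⟨j, rfl⟩ : ∃ j, l = j + 1 := ⟨l - 1, by omega⟩
    exact ih (step j (by omega) hpl)

open MvPolynomial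

theorem IsMonomialIdeal.mem_assInfty_of_frequently {σ K : Type*} [Finite σ] [Field K]
    {I p : Ideal (MvPolynomial σ K)} (hI : IsMonomialIdeal I) (hI0 : I ≠ ⊥)
    (h : ∀ N, ∃ k, N ≤ k ∧ p ∈ assPrimes (I ^ k)) : p ∈ assInfty I := by
  refine _root_.mem_assInfty_of_frequently (fun k hk => ?_) h
  obtain ⟨V, rfl⟩ := (hI.pow _).exists_eq_span_X_of_mem_assPrimes hk
  obtain ⟨a, ha⟩ := ((hI.pow _).span_X_mem_assPrimes_iff V).1 hk
  exact ⟨_, ha.mem_pow hI hI0, ((hI.pow _).isColonWitness_iff V a).1 ha⟩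

end Persistence

/-! ### Powers of `I + J` and their colon witnesses. -/

section Sum

open MvPolynomial

variable {K : Type*} [Field K] {n m : ℕ}

theorem IsMonomialIdeal.monomial_mem_extendX {I : Ideal (MvPolynomial (Fin n) K)}
    (hI : IsMonomialIdeal I) (a : Fin n →₀ ℕ) (b : Fin m →₀ ℕ) :
    monomial (a.sumElim b) (1 : K) ∈ extendX m I ↔ monomial a (1 : K) ∈ I := by
  constructor
  · obtain ⟨A, rfl⟩ := hI
    rw [extendX, Ideal.map_span, Set.image_image]
    simp_rw [rename_monomial]
    rw [← Set.image_image (fun a => monomial a (1 : K)) (Finsupp.mapDomain Sum.inl),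
      monomial_mem_span_iff, monomial_mem_span_iff]
    rintro ⟨_, ⟨c, hc, rfl⟩, h⟩
    refine ⟨c, hc, fun i => ?_⟩
    simpa [Finsupp.mapDomain_apply Sum.inl_injective, Finsupp.sumElim_inl] using h (Sum.inl i)
  · intro h
    have := Ideal.mem_map_of_mem (rename (R := K) (Sum.inl : Fin n → Fin n ⊕ Fin m)) h
    rw [rename_monomial] at this
    refine monomial_mem_of_le ?_ this
    rw [Finsupp.sumElim_eq_add]
    exact le_self_add

theorem IsMonomialIdeal.monomial_mem_extendY {J : Ideal (MvPolynomial (Fin m) K)}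
    (hJ : IsMonomialIdeal J) (a : Fin n →₀ ℕ) (b : Fin m →₀ ℕ) :
    monomial (a.sumElim b) (1 : K) ∈ extendY n J ↔ monomial b (1 : K) ∈ J := by
  constructor
  · obtain ⟨A, rfl⟩ := hJ
    rw [extendY, Ideal.map_span, Set.image_image]
    simp_rw [rename_monomial]
    rw [← Set.image_image (fun a => monomial a (1 : K)) (Finsupp.mapDomain Sum.inr),
      monomial_mem_span_iff, monomial_mem_span_iff]
    rintro ⟨_, ⟨c, hc, rfl⟩, h⟩
    refine ⟨c, hc, fun i => ?_⟩
    simpa [Finsupp.mapDomain_apply Sum.inr_injective, Finsupp.sumElim_inr] using h (Sum.inr i)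
  · intro h
    have := Ideal.mem_map_of_mem (rename (R := K) (Sum.inr : Fin m → Fin n ⊕ Fin m)) h
    rw [rename_monomial] at this
    refine monomial_mem_of_le ?_ this
    rw [Finsupp.sumElim_eq_add]
    exact le_add_self

theorem exists_eq_sumElim (c : Fin n ⊕ Fin m →₀ ℕ) :
    ∃ (a : Fin n →₀ ℕ) (b : Fin m →₀ ℕ), c = a.sumElim b :=
  ⟨_, _, (Finsupp.comapDomain_sumElim_comapDomain c).symm⟩

theorem sumElim_inj {a c : Fin n →₀ ℕ} {b d : Fin m →₀ ℕ} (h : a.sumElim b = c.sumElim d) :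
    a = c ∧ b = d :=
  ⟨by simpa using congrArg (Finsupp.comapDomain Sum.inl · Sum.inl_injective.injOn) h,
   by simpa using congrArg (Finsupp.comapDomain Sum.inr · Sum.inr_injective.injOn) h⟩

variable {I : Ideal (MvPolynomial (Fin n) K)} {J : Ideal (MvPolynomial (Fin m) K)}

theorem isMonomialIdeal_extend_add (hI : IsMonomialIdeal I) (hJ : IsMonomialIdeal J) :
    IsMonomialIdeal (extendX m I + extendY n J) :=
  (hI.map_rename _).sup (hJ.map_rename _)

theorem monomial_mem_extend_add_pow_iff (hI : IsMonomialIdeal I) (hJ : IsMonomialIdeal J) (k : ℕ)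
    (a : Fin n →₀ ℕ) (b : Fin m →₀ ℕ) :
    monomial (a.sumElim b) (1 : K) ∈ (extendX m I + extendY n J) ^ k ↔
      ∃ i j, i + j = k ∧ monomial a (1 : K) ∈ I ^ i ∧ monomial b (1 : K) ∈ J ^ j := by
  have hX : IsMonomialIdeal (extendX m I) := hI.map_rename _
  have hY : IsMonomialIdeal (extendY n J) := hJ.map_rename _
  constructor
  · induction k generalizing a b with
    | zero => exact fun _ => ⟨0, 0, rfl, by simp, by simp⟩
    | succ k ih =>
      rw [pow_succ, ((isMonomialIdeal_extend_add hI hJ).pow k).monomial_mem_mul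
        (isMonomialIdeal_extend_add hI hJ)]
      rintro ⟨c, d, hc, hd, hcd⟩
      obtain ⟨c₁, c₂, rfl⟩ := exists_eq_sumElim c
      obtain ⟨d₁, d₂, rfl⟩ := exists_eq_sumElim d
      rw [← Finsupp.sumElim_add] at hcd
      obtain ⟨rfl, rfl⟩ := sumElim_inj hcd
      obtain ⟨i, j, rfl, hi, hj⟩ := ih _ _ hc
      rw [Submodule.add_eq_sup, hX.monomial_mem_sup hY, hI.monomial_mem_extendX,
        hJ.monomial_mem_extendY] at hd
      obtain hd | hd := hd
      · refine ⟨i + 1, j, by omega, ?_, monomial_mem_of_le (by simp) hj⟩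
        rw [pow_succ]
        exact ((hI.pow i).monomial_mem_mul hI).2 ⟨_, _, hi, hd, rfl⟩
      · refine ⟨i, j + 1, by omega, monomial_mem_of_le (by simp) hi, ?_⟩
        rw [pow_succ]
        exact ((hJ.pow j).monomial_mem_mul hJ).2 ⟨_, _, hj, hd, rfl⟩
  · rintro ⟨i, j, rfl, hi, hj⟩
    have h1 := ((hI.pow i).monomial_mem_extendX a (0 : Fin m →₀ ℕ)).2 hi
    have h2 := ((hJ.pow j).monomial_mem_extendY (0 : Fin n →₀ ℕ) b).2 hj
    have h3 := Ideal.mul_mem_mul h1 h2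
    rw [monomial_mul, ← Finsupp.sumElim_add, add_zero, zero_add, mul_one] at h3
    rw [extendX, extendY, Ideal.map_pow, Ideal.map_pow] at h3
    rw [pow_add]
    exact Ideal.mul_mono (Ideal.pow_right_mono le_sup_left i)
      (Ideal.pow_right_mono le_sup_right j) h3

theorem extend_span_X_add (V : Set (Fin n)) (W : Set (Fin m)) :
    extendX m (Ideal.span (X '' V : Set (MvPolynomial (Fin n) K))) +
      extendY n (Ideal.span (X '' W)) = Ideal.span (X '' (Sum.inl '' V ∪ Sum.inr '' W)) := by
  rw [extendX, extendY, Ideal.map_span, Ideal.map_span, Submodule.add_eq_sup, ← Ideal.span_union,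
    Set.image_union, Set.image_image, Set.image_image, Set.image_image, Set.image_image]
  simp [rename_X]

theorem exists_mem_union_sumElim_ne_zero_iff {V : Set (Fin n)} {W : Set (Fin m)}
    {u : Fin n →₀ ℕ} {v : Fin m →₀ ℕ} :
    (∃ i ∈ Sum.inl '' V ∪ Sum.inr '' W, u.sumElim v i ≠ 0) ↔
      (∃ i ∈ V, u i ≠ 0) ∨ ∃ i ∈ W, v i ≠ 0 := by
  simp [Finsupp.sumElim_apply]

theorem IsColonWitness.extend_add (hI : IsMonomialIdeal I) (hJ : IsMonomialIdeal J)
    (hI0 : I ≠ ⊥) (hJ0 : J ≠ ⊥) {V : Set (Fin n)} {W : Set (Fin m)} {i j : ℕ}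
    {a : Fin n →₀ ℕ} {b : Fin m →₀ ℕ} (ha : IsColonWitness (I ^ (i + 1)) V a)
    (hb : IsColonWitness (J ^ (j + 1)) W b) :
    IsColonWitness ((extendX m I + extendY n J) ^ (i + j + 1)) (Sum.inl '' V ∪ Sum.inr '' W)
      (a.sumElim b) := by
  intro c
  obtain ⟨u, v, rfl⟩ := exists_eq_sumElim c
  rw [exists_mem_union_sumElim_ne_zero_iff, ← Finsupp.sumElim_add,
    monomial_mem_extend_add_pow_iff hI hJ, ← ha u, ← hb v]
  constructor
  · rintro ⟨i', j', hij, hi, hj⟩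
    by_cases h : i + 1 ≤ i'
    · exact Or.inl (Ideal.pow_le_pow_right h hi)
    · exact Or.inr (Ideal.pow_le_pow_right (by omega) hj)
  · rintro (h | h)
    · exact ⟨i + 1, j, by omega, h, monomial_mem_of_le (by simp) (hb.mem_pow hJ hJ0)⟩
    · exact ⟨i, j + 1, by omega, monomial_mem_of_le (by simp) (ha.mem_pow hI hI0), h⟩

theorem IsColonWitness.of_extend_add (hI : IsMonomialIdeal I) (hJ : IsMonomialIdeal J)
    {V : Set (Fin n)} {W : Set (Fin m)} {k : ℕ} {a : Fin n →₀ ℕ} {b : Fin m →₀ ℕ}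
    (h : IsColonWitness ((extendX m I + extendY n J) ^ k) (Sum.inl '' V ∪ Sum.inr '' W)
      (a.sumElim b)) :
    ∃ i j, k ≤ i + j ∧ IsColonWitness (I ^ i) V a ∧ IsColonWitness (J ^ j) W b := by
  classical
  have h' : ∀ u v, (∃ i j, i + j = k ∧ monomial (a + u) (1 : K) ∈ I ^ i ∧
      monomial (b + v) (1 : K) ∈ J ^ j) ↔ (∃ i ∈ V, u i ≠ 0) ∨ ∃ i ∈ W, v i ≠ 0 := by
    intro u v
    rw [← monomial_mem_extend_add_pow_iff hI hJ, ← exists_mem_union_sumElim_ne_zero_iff, ← h,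
      Finsupp.sumElim_add]
  -- The `I`-adic order of `x^a` and the `J`-adic order of `y^b`, capped at `k`.
  set i₀ := Nat.findGreatest (fun i => monomial a (1 : K) ∈ I ^ i) k
  set j₀ := Nat.findGreatest (fun j => monomial b (1 : K) ∈ J ^ j) k
  have hi₀ : monomial a (1 : K) ∈ I ^ i₀ :=
    Nat.findGreatest_spec (P := fun i => monomial a (1 : K) ∈ I ^ i) (Nat.zero_le k) (by simp)
  have hj₀ : monomial b (1 : K) ∈ J ^ j₀ :=
    Nat.findGreatest_spec (P := fun j => monomial b (1 : K) ∈ J ^ j) (Nat.zero_le k) (by simp)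
  have hi₀k : i₀ ≤ k := Nat.findGreatest_le k
  have hj₀k : j₀ ≤ k := Nat.findGreatest_le k
  refine ⟨k - j₀, k - i₀, ?_, fun u => ⟨fun hu => ?_, fun hu => ?_⟩,
    fun v => ⟨fun hv => ?_, fun hv => ?_⟩⟩
  -- Here `i₀ + j₀ < k`, since otherwise `x^a y^b` itself would lie in `(I + J)^k`.
  · by_contra! hlt
    have := (h' 0 0).1 ⟨k - j₀, j₀, by omega,
      by simpa using Ideal.pow_le_pow_right (by omega) hi₀, by simpa using hj₀⟩
    simp at this
  · simpa using (h' u 0).1 ⟨k - j₀, j₀, by omega, hu, by simpa using hj₀⟩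
  · obtain ⟨i, j, hij, hi, hj⟩ := (h' u 0).2 (Or.inl hu)
    have : j ≤ j₀ := Nat.le_findGreatest (by omega) (by simpa using hj)
    exact Ideal.pow_le_pow_right (by omega) hi
  · simpa using (h' 0 v).1 ⟨i₀, k - i₀, by omega, by simpa using hi₀, hv⟩
  · obtain ⟨i, j, hij, hi, hj⟩ := (h' 0 v).2 (Or.inr hv)
    have : i ≤ i₀ := Nat.le_findGreatest (by omega) (by simpa using hi)
    exact Ideal.pow_le_pow_right (by omega) hj

theorem extend_add_mem_assPrimes (hI : IsMonomialIdeal I) (hJ : IsMonomialIdeal J)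
    (hI0 : I ≠ ⊥) (hJ0 : J ≠ ⊥) {p : Ideal (MvPolynomial (Fin n) K)}
    {q : Ideal (MvPolynomial (Fin m) K)} {i j : ℕ} (hp : p ∈ assPrimes (I ^ (i + 1)))
    (hq : q ∈ assPrimes (J ^ (j + 1))) :
    extendX m p + extendY n q ∈ assPrimes ((extendX m I + extendY n J) ^ (i + j + 1)) := by
  obtain ⟨V, rfl⟩ := (hI.pow _).exists_eq_span_X_of_mem_assPrimes hp
  obtain ⟨W, rfl⟩ := (hJ.pow _).exists_eq_span_X_of_mem_assPrimes hq
  obtain ⟨a, ha⟩ := ((hI.pow _).span_X_mem_assPrimes_iff V).1 hp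
  obtain ⟨b, hb⟩ := ((hJ.pow _).span_X_mem_assPrimes_iff W).1 hq
  rw [extend_span_X_add, ((isMonomialIdeal_extend_add hI hJ).pow _).span_X_mem_assPrimes_iff]
  exact ⟨_, ha.extend_add hI hJ hI0 hJ0 hb⟩

theorem mem_assStar_iff {R : Type*} [CommRing R] {I p : Ideal R} :
    p ∈ assStar I ↔ ∃ k : ℕ, p ∈ assPrimes (I ^ (k + 1)) := by
  simp only [assStar, Set.mem_iUnion, exists_prop]
  constructor
  · rintro ⟨k, hk, h⟩
    obtain ⟨l, rfl⟩ := Nat.exists_eq_add_of_le' hk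
    exact ⟨l, h⟩
  · rintro ⟨k, h⟩
    exact ⟨k + 1, by omega, h⟩

end Sum

/-! ### The two inclusions. -/

theorem theorem3p1 {K : Type*} [Field K] (n m : ℕ)
    (I : Ideal (MvPolynomial (Fin n) K)) (J : Ideal (MvPolynomial (Fin m) K))
    (hI : IsMonomialIdeal I) (hJ : IsMonomialIdeal J)
    (hI_ne_zero : I ≠ ⊥) (hJ_ne_zero : J ≠ ⊥)
    (hI_proper : I ≠ ⊤) (hJ_proper : J ≠ ⊤) :
    assInfty (extendX m I + extendY n J) =
      (⋃ p ∈ assStar I, ⋃ q ∈ assInfty J, {extendX m p + extendY n q}) ∪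
      (⋃ p ∈ assInfty I, ⋃ q ∈ assStar J, {extendX m p + extendY n q}) := by
  apply Set.Subset.antisymm
  · rintro P ⟨k₀, hP⟩
    have hIJ := isMonomialIdeal_extend_add hI hJ
    obtain ⟨U, rfl⟩ := (hIJ.pow _).exists_eq_span_X_of_mem_assPrimes (hP k₀ le_rfl)
    obtain ⟨V, W, rfl⟩ : ∃ (V : Set (Fin n)) (W : Set (Fin m)),
        U = Sum.inl '' V ∪ Sum.inr '' W :=
      ⟨_, _, (Set.image_preimage_inl_union_image_preimage_inr U).symm⟩
    have key : ∀ k, k₀ ≤ k → ∃ i j : ℕ, k ≤ i + 1 + (j + 1) ∧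
        Ideal.span (MvPolynomial.X '' V) ∈ assPrimes (I ^ (i + 1)) ∧
        Ideal.span (MvPolynomial.X '' W) ∈ assPrimes (J ^ (j + 1)) := by
      intro k hk
      obtain ⟨c, hc⟩ := ((hIJ.pow _).span_X_mem_assPrimes_iff _).1 (hP k hk)
      obtain ⟨a, b, rfl⟩ := exists_eq_sumElim c
      obtain ⟨i, j, hij, hi, hj⟩ := hc.of_extend_add hI hJ
      obtain ⟨i, rfl⟩ := hi.exists_succ
      obtain ⟨j, rfl⟩ := hj.exists_succ
      exact ⟨i, j, hij, ((hI.pow _).span_X_mem_assPrimes_iff V).2 ⟨a, hi⟩,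
        ((hJ.pow _).span_X_mem_assPrimes_iff W).2 ⟨b, hj⟩⟩
    obtain ⟨i₀, j₀, -, hi₀, hj₀⟩ := key k₀ le_rfl
    rw [← extend_span_X_add]
    by_cases hfreq : ∀ N : ℕ, ∃ k : ℕ, N ≤ k ∧ Ideal.span (MvPolynomial.X '' V) ∈ assPrimes (I ^ k)
    · refine Or.inr ?_
      simp only [Set.mem_iUnion, Set.mem_singleton_iff]
      exact ⟨_, hI.mem_assInfty_of_frequently hI_ne_zero hfreq, _,
        mem_assStar_iff.2 ⟨j₀, hj₀⟩, rfl⟩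
    · refine Or.inl ?_
      simp only [Set.mem_iUnion, Set.mem_singleton_iff]
      refine ⟨_, mem_assStar_iff.2 ⟨i₀, hi₀⟩, _,
        hJ.mem_assInfty_of_frequently hJ_ne_zero fun N' => ?_, rfl⟩
      push Not at hfreq
      obtain ⟨N, hN⟩ := hfreq
      -- The prime of `V` is not associated to `I^k` for `k ≥ N`, so `i + 1 < N` and the rest of the
      -- exponent forces `j + 1 ≥ N'`.
      obtain ⟨i, j, hij, hi, hj⟩ := key (k₀ + N + N') (by omega)
      have : i + 1 < N := by
        by_contra! h
        exact hN _ h hi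
      exact ⟨j + 1, by omega, hj⟩
  · refine Set.union_subset ?_ ?_
    · simp only [Set.iUnion_subset_iff, Set.singleton_subset_iff]
      rintro p hp q ⟨k₀, hq⟩
      obtain ⟨i, hi⟩ := mem_assStar_iff.1 hp
      refine ⟨i + k₀ + 1, fun k hk => ?_⟩
      obtain ⟨l, rfl⟩ := Nat.exists_eq_add_of_le hk
      have := extend_add_mem_assPrimes hI hJ hI_ne_zero hJ_ne_zero hi (hq (k₀ + l + 1) (by omega))
      rwa [show i + (k₀ + l) + 1 = i + k₀ + 1 + l by omega] at this
    · simp only [Set.iUnion_subset_iff, Set.singleton_subset_iff]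
      rintro p ⟨k₀, hp⟩ q hq
      obtain ⟨j, hj⟩ := mem_assStar_iff.1 hq
      refine ⟨k₀ + j + 1, fun k hk => ?_⟩
      obtain ⟨l, rfl⟩ := Nat.exists_eq_add_of_le hk
      have := extend_add_mem_assPrimes hI hJ hI_ne_zero hJ_ne_zero (hp (k₀ + l + 1) (by omega)) hj
      rwa [show k₀ + l + j + 1 = k₀ + j + 1 + l by omega] at this
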